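/- Notation. Let $s(n,k)$ denote the (unsigned) Stirling numbers of the first kind, $x(x-1)\cdots(x-n+1)=\sum_{k=0}^n(-1)^{n-k}s(n,k)x^k$, let $\nu_2$ be the $2$-adic valuation and $\sigma_2(m)$ the sum of the binary digits of $m$. The higher order Bernoulli polynomials are defined by $\left(\frac{t}{e^t-1}\right)^{l}e^{tx}=\sum_{n\ge 0}B_n^{(l)}(x)\frac{t^n}{n!}$, and the maximum pole of a rational polynomial (with respect to $2$) is the exponent of the highest power of $2$ dividing the denominator of one of its coefficients. For $1\le k\le n$ let $M$ and $M'$ be the maximum poles of $B_{n-k}^{(n)}(x)$ and $B_{n-k}^{(n+1)}(x)$. Then $s(n,k)$ is called - a minimum zero case (MZC) if $\nu_2(s(n,k))=\sigma_2(k-1)-\sigma_2(n-1)$; - an almost minimum zero case (AMZC) if $\nu_2(s(n,k))=\nu_2\left(\binom{n-1}{k-1}\right)-M$; - a shifted almost minimum zero case (SAMZC) if $\nu_2(s(n,k))=\nu_2\left(\binom{n}{k}\right)-M'$. Theorem. Let $n=2^h$ with $h\ge 1$. 1. For $0<k<n$, $s(n,k)$ is a SAMZC if and only if either $k$ is even and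 $2^{h-1}\le k<2^h$, or $k=2^h-1$, or $k=2^{h-1}-1$. 2. For $0<k<n$, $s(n,k)$ is never a MZC, and it is an AMZC if and only if $k=2^{h-1}$. 3. If $k$ is even and $2^{h-1}\le k<2^h$, then $\nu_2(s(n,k))=h-\nu_2(k)-1$. 4. If $k>0$ and $k=2^h-1$ or $k=2^{h-1}-1$, then $\nu_2(s(n,k))=h-1=h-1-\nu_2(k)$. 5. If $1\le k\le n$ and $s(n,k)$ is a SAMZC, then $\nu_2(s(n+1,k+1))=\nu_2(s(n,k))$. -/

import Mathlib

noncomputable section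

namespace StirlingCases

/-- The power series `(e ^ t - 1) / t = ∑ t ^ i / (i + 1)!` over `ℚ`. -/
def expSubOneDivT : PowerSeries ℚ :=
  PowerSeries.mk fun i => (1 : ℚ) / ((i + 1).factorial : ℚ)

/-- The higher order Bernoulli polynomial `B_n^{(l)}(x)` of order `l ≥ 0`, from its exponential
generating function `(t / (e ^ t - 1)) ^ l * e ^ (t * x) = ∑ B_n^{(l)}(x) * t ^ n / n!`.
The power series on the left has its coefficients in `ℚ[x]`. -/
def higherBernoulli (l n : ℕ) : Polynomial ℚ :=
  (n.factorial : ℚ) •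
    PowerSeries.coeff n
      (PowerSeries.map (Polynomial.C : ℚ →+* Polynomial ℚ) (expSubOneDivT⁻¹ ^ l) *
        PowerSeries.rescale (Polynomial.X : Polynomial ℚ) (PowerSeries.exp (Polynomial ℚ)))

/-- The maximum pole of a rational polynomial: the exponent of the highest power of `p` in the
denominator of any of its coefficients. -/
def maxPole (p : ℕ) (f : Polynomial ℚ) : ℕ :=
  f.support.sup fun i => padicValNat p (f.coeff i).den

/-- The sum of the digits of `m` in base `p`. -/
def digitSum (p m : ℕ) : ℕ := (Nat.digits p m).sum

/-- Minimum zero case (for `1 ≤ k ≤ n`): the estimate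
`ν_p(s(n,k)) ≥ (σ_p(k-1) - σ_p(n-1)) / (p-1)` is sharp. The Stirling number is required to be
nonzero, so that its valuation is finite. -/
def IsMZC (p n k : ℕ) : Prop :=
  Nat.stirlingFirst n k ≠ 0 ∧
    (padicValNat p (Nat.stirlingFirst n k) : ℚ) =
      ((digitSum p (k - 1) : ℚ) - (digitSum p (n - 1) : ℚ)) / ((p : ℚ) - 1)

/-- Almost minimum zero case (for `1 ≤ k ≤ n`): the estimate
`ν_p(s(n,k)) ≥ ν_p(binom (n-1) (k-1)) - M` is sharp, where `M` is the maximum pole of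
`B_{n-k}^{(n)}(x)`. -/
def IsAMZC (p n k : ℕ) : Prop :=
  Nat.stirlingFirst n k ≠ 0 ∧
    (padicValNat p (Nat.stirlingFirst n k) : ℤ) =
      (padicValNat p ((n - 1).choose (k - 1)) : ℤ) - (maxPole p (higherBernoulli n (n - k)) : ℤ)

/-- Shifted almost minimum zero case (for `0 ≤ k ≤ n`): the estimate
`ν_p(s(n,k)) ≥ ν_p(binom n k) - M'` is sharp, where `M'` is the maximum pole of
`B_{n-k}^{(n+1)}(x)`. -/
def IsSAMZC (p n k : ℕ) : Prop :=
  Nat.stirlingFirst n k ≠ 0 ∧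
    (padicValNat p (Nat.stirlingFirst n k) : ℤ) =
      (padicValNat p (n.choose k) : ℤ) - (maxPole p (higherBernoulli (n + 1) (n - k)) : ℤ)

end StirlingCases

end

namespace StirlingCases

/-! ### Rising factorials of length `2 ^ h` modulo powers of two -/

section risingFactorial
open Polynomial

/-! Let P_n = x(x+1)...(x+n-1), with coefficients s(n,k), and n = 2^h.

Valuations: k s(n,k) is a coefficient of x P_n'. Doubling, P_{2m}(x) = P_m(x) P_m(x+m), gives P_n' =
2^(h-1) (U^(2^(h-1)-2) (U+1) + 2B) with U = x(x+1), for h ≥ 2. So 2^(h-1) always divides k s(n,k),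
and reduction modulo 2 finds the k where 2^h does not (`mul_stirlingFirst_two_pow`).

Poles: binom(n,k) times the coefficients of B_{n-k}^{(n+1)} are, up to sign, binom(k+i,k)
s(n+1,k+i+1), the coefficients of the k-th Hasse derivative of P_n(x+1). Translating back, s(n,k) is
a SAMZC iff it has the least valuation among all binom(k+i,k) s(n,k+i) (`isSAMZC_iff`). The AMZC
criterion uses binom(k-1+i,k-1) s(n,k+i) instead.

The identity k binom(k+i,k) = (k+i) binom(k+i-1,k-1) joins the two halves. -/

theorem coeff_ascPochhammer_int (n k : ℕ) :
    (ascPochhammer ℤ n).coeff k = (Nat.stirlingFirst n k : ℤ) := by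
  induction n generalizing k with
  | zero => cases k <;> simp [coeff_one, Nat.stirlingFirst]
  | succ n ih =>
    rw [ascPochhammer_succ_right, mul_add, coeff_add, ← C_eq_natCast, coeff_mul_C]
    cases k with
    | zero => cases n <;> simp [ih, Nat.stirlingFirst]
    | succ k => rw [coeff_mul_X, ih, ih, Nat.stirlingFirst_succ_succ]; push_cast; ring

theorem exists_comp_X_add_C {R : Type*} [CommRing R] (p : R[X]) (a : R) :
    ∃ q : R[X], p.comp (X + C a) = p + C a * derivative p + C a ^ 2 * q := by
  obtain ⟨c, hc⟩ := exists_mul_sq_add_linear_part_eq_eval_add (p.map C) X (C a)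
  refine ⟨c, ?_⟩
  rw [derivative_map, eval_map, eval_map, eval_map] at hc
  have e (q : R[X]) : eval₂ C X q = q := eval₂_C_X
  rw [e, e] at hc
  rw [comp, ← hc]; ring

/-- For `n = 2 ^ (r + 2)`, the rising factorial modulo `2` and its derivative modulo `n`. -/
theorem ascPochhammer_two_pow_congr (r : ℕ) :
    ∃ A B : ℤ[X],
      ascPochhammer ℤ (2 ^ (r + 2)) = (X * (X + 1)) ^ (2 ^ (r + 1)) + 2 * A ∧
      derivative (ascPochhammer ℤ (2 ^ (r + 2))) =
        2 ^ (r + 1) * ((X * (X + 1)) ^ (2 ^ (r + 1) - 2) * (X * (X + 1) + 1) + 2 * B) := by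
  induction r with
  | zero =>
    have e : ascPochhammer ℤ (2 ^ (0 + 2)) = X ^ 4 + 6 * X ^ 3 + 11 * X ^ 2 + 6 * X := by
      simp only [zero_add, show 2 ^ 2 = 0 + 1 + 1 + 1 + 1 by rfl, ascPochhammer_succ_right,
        ascPochhammer_zero]
      push_cast; ring
    have d : derivative (X ^ 4 + 6 * X ^ 3 + 11 * X ^ 2 + 6 * X : ℤ[X]) =
        4 * X ^ 3 + 18 * X ^ 2 + 22 * X + 6 := by
      have c (m : ℕ) [m.AtLeastTwo] : derivative (OfNat.ofNat m : ℤ[X]) = 0 :=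
        derivative_ofNat m
      simp only [derivative_add, derivative_mul, derivative_X_pow, derivative_X, c]
      simp; ring
    refine ⟨2 * X ^ 3 + 5 * X ^ 2 + 3 * X, X ^ 3 + 4 * X ^ 2 + 5 * X + 1, ?_, ?_⟩
    · rw [e]; ring
    · rw [e, d]; norm_num; ring
  | succ r ih =>
    obtain ⟨A, B, hA, hB⟩ := ih
    set q := ascPochhammer ℤ (2 ^ (r + 2)) with hq
    obtain ⟨E, hE⟩ := exists_comp_X_add_C q ((2 : ℤ) ^ (r + 2))
    have hC : (C ((2 : ℤ) ^ (r + 2)) : ℤ[X]) = 2 ^ (r + 2) := by simp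
    -- Doubling formula, with the shifted factor expanded to first order in the shift.
    have hmul : ascPochhammer ℤ (2 ^ (r + 1 + 2)) =
        q * (q + 2 ^ (r + 2) * derivative q + (2 ^ (r + 2)) ^ 2 * E) := by
      rw [show 2 ^ (r + 1 + 2) = 2 ^ (r + 2) + 2 ^ (r + 2) by ring, ← ascPochhammer_mul, ← hC, ← hE,
        hq]
      congr 2
    set D := (X * (X + 1)) ^ (2 ^ (r + 1) - 2) * (X * (X + 1) + 1) + 2 * B with hD
    have hpow : (2 : ℤ[X]) ^ (r + 2) = C ((2 : ℤ) ^ (r + 2)) := hC.symm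
    have hpow' : (2 : ℤ[X]) ^ (r + 1) = C ((2 : ℤ) ^ (r + 1)) := by simp
    have hder2 : derivative (derivative q) = 2 ^ (r + 1) * derivative D := by
      rw [hB, hpow', derivative_C_mul]
    have hder : derivative (ascPochhammer ℤ (2 ^ (r + 1 + 2))) =
        derivative q * (q + 2 ^ (r + 2) * derivative q + (2 ^ (r + 2)) ^ 2 * E) +
        q * (derivative q + 2 ^ (r + 2) * derivative (derivative q) +
          (2 ^ (r + 2)) ^ 2 * derivative E) := by
      rw [hmul, hpow, ← C_pow]
      simp only [derivative_add, derivative_mul, derivative_C]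
      ring
    have hN : 2 ^ (r + 1 + 1) - 2 = 2 ^ (r + 1) + (2 ^ (r + 1) - 2) := by
      have : 2 ≤ 2 ^ (r + 1) := by rw [pow_succ]; have := Nat.one_le_two_pow (n := r); omega
      rw [pow_succ 2 (r + 1)]; omega
    set U : ℤ[X] := X * (X + 1) with hU
    set V := U ^ (2 ^ (r + 1)) with hV
    set W := U ^ (2 ^ (r + 1) - 2) with hW
    set s : ℤ[X] := 2 ^ r with hs
    have h1 : (2 : ℤ[X]) ^ (r + 1) = 2 * s := by rw [hs]; ring
    have h2 : (2 : ℤ[X]) ^ (r + 2) = 4 * s := by rw [hs]; ring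
    have h3 : U ^ (2 ^ (r + 1 + 1)) = V ^ 2 := by rw [hV, ← pow_mul, pow_succ 2 (r + 1)]
    have h4 : (2 : ℤ[X]) ^ (r + 1 + 1) = 4 * s := by rw [hs]; ring
    -- Here q = V + 2A and q' = 2sD. The main term 2qq' = 4s(V + 2A)D yields VW(U + 1) modulo 2
    -- after removing 4s; all other terms are multiples of 8s because q' and q'' are both multiples
    -- of 2s.
    refine ⟨2 * V * A + 2 * A ^ 2 + q * (2 * s * derivative q + 8 * s ^ 2 * E),
      V * B + A * D + s * (2 * s * D ^ 2 + 4 * s * D * E +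
        q * derivative D + 2 * q * derivative E), ?_, ?_⟩
    · rw [hmul, h3, h2]
      linear_combination (q + V + 2 * A) * hA
    · have hVW : U ^ (2 ^ (r + 1 + 1) - 2) = V * W := by rw [hN, pow_add]
      rw [hVW, hder, hder2, hB, h4, h1]
      linear_combination (4 * s * D) * hA + (4 * s * V) * hD

/-- In characteristic 2, (1+X)^(2^a) = X^(2^a) - 1; divide by 1+X = X-1. -/
theorem one_add_X_pow_two_pow_sub_one (a : ℕ) :
    (1 + X : (ZMod 2)[X]) ^ (2 ^ a - 1) = ∑ i ∈ Finset.range (2 ^ a), X ^ i := by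
  have h0 : (1 + X : (ZMod 2)[X]) ≠ 0 := by
    rw [add_comm]; exact (monic_X_add_C (1 : ZMod 2)).ne_zero
  refine mul_right_cancel₀ h0 ?_
  rw [← pow_succ, Nat.sub_add_cancel Nat.one_le_two_pow, add_comm (1 : (ZMod 2)[X]) X,
    add_pow_char_pow, one_pow]
  have h2 : (X + 1 : (ZMod 2)[X]) = X - 1 := (CharTwo.sub_eq_add _ _).symm
  rw [h2, geom_sum_mul, CharTwo.sub_eq_add]

theorem one_add_X_pow_two_pow_sub_two (a : ℕ) :
    (1 + X : (ZMod 2)[X]) ^ (2 ^ (a + 1) - 2) = ∑ i ∈ Finset.range (2 ^ a), X ^ (2 * i) := by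
  rw [pow_succ, show 2 ^ a * 2 - 2 = (2 ^ a - 1) * 2 by omega, pow_mul,
    one_add_X_pow_two_pow_sub_one, sum_pow_char]
  exact Finset.sum_congr rfl fun i _ => by rw [← pow_mul, mul_comm]

/-- The indices `0 < k < 2 ^ h` for which `k * s(2 ^ h, k)` has `2`-adic valuation `h - 1`. -/
def IsLowIndex (h k : ℕ) : Prop :=
  (Even k ∧ 2 ^ (h - 1) ≤ k ∧ k < 2 ^ h) ∨ k = 2 ^ h - 1 ∨ k = 2 ^ (h - 1) - 1

open Classical in
-- With m = 2^(r+1), the polynomial is X^m (1+X)^(m-1) + X^(m-1) (1+X)^(m-2). The first term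
-- contributes every exponent in [m, 2m), the second the exponents m-1, m+1, ..., 2m-3; common
-- exponents cancel.
theorem coeff_leading_term (r k : ℕ) (hk : 0 < k) :
    (X * ((X * (X + 1)) ^ (2 ^ (r + 1) - 2) * (X * (X + 1) + 1)) : (ZMod 2)[X]).coeff k =
      if IsLowIndex (r + 2) k then 1 else 0 := by
  have hm : 2 ≤ 2 ^ (r + 1) := by rw [pow_succ]; have := Nat.one_le_two_pow (n := r); omega
  have e : (X * ((X * (X + 1)) ^ (2 ^ (r + 1) - 2) * (X * (X + 1) + 1)) : (ZMod 2)[X]) =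
      (∑ i ∈ Finset.range (2 ^ (r + 1)), X ^ i) * X ^ (2 ^ (r + 1)) +
      (∑ i ∈ Finset.range (2 ^ r), X ^ (2 * i)) * X ^ (2 ^ (r + 1) - 1) := by
    rw [← one_add_X_pow_two_pow_sub_two, ← one_add_X_pow_two_pow_sub_one]
    obtain ⟨m, hm'⟩ := Nat.exists_eq_add_of_le hm
    rw [hm', show 2 + m - 2 = m by omega, show 2 + m - 1 = m + 1 by omega, mul_pow]
    ring
  rw [e, coeff_add, coeff_mul_X_pow', coeff_mul_X_pow']
  simp only [finsetSum_coeff, coeff_X_pow]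
  have s1 (j M : ℕ) : (∑ i ∈ Finset.range M, if j = i then (1 : ZMod 2) else 0) =
      if j < M then 1 else 0 := by
    simp
  have s2 (j M : ℕ) : (∑ i ∈ Finset.range M, if j = 2 * i then (1 : ZMod 2) else 0) =
      if Even j ∧ j < 2 * M then 1 else 0 := by
    rcases Nat.even_or_odd' j with ⟨c, rfl | rfl⟩
    · simp
    · have : ∀ i, ¬ (2 * c + 1 = 2 * i) := by intro i; omega
      simp [this]
  rw [s1, s2]
  have p1 : 2 ^ (r + 1) = 2 * 2 ^ r := by ring
  have p2 : 2 ^ (r + 2) = 2 * (2 * 2 ^ r) := by ring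
  have p3 := Nat.one_le_two_pow (n := r)
  have p4 : 2 ^ (r + 2 - 1) = 2 * 2 ^ r := by rw [← p1]; rfl
  unfold IsLowIndex
  rw [p1, p2, p4]
  generalize 2 ^ r = t at *
  simp only [Nat.even_iff]
  have two : (1 : ZMod 2) + 1 = 0 := rfl
  by_cases hk1 : 2 * t ≤ k
  · have hk2 : 2 * t - 1 ≤ k := by omega
    rw [if_pos hk1, if_pos hk2]
    by_cases hk3 : k < 4 * t
    · rw [if_pos (by omega)]
      by_cases hk4 : k % 2 = 0
      · rw [if_neg (by omega), if_pos (by omega), add_zero]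
      · by_cases hk5 : k = 4 * t - 1
        · rw [if_neg (by omega), if_pos (by omega), add_zero]
        · rw [if_pos (by omega), if_neg (by omega), two]
    · rw [if_neg (by omega), if_neg (by omega), if_neg (by omega), add_zero]
  · rw [if_neg hk1]
    by_cases hk2 : k = 2 * t - 1
    · rw [if_pos (by omega), if_pos (by omega), if_pos (by omega), zero_add]
    · rw [if_neg (by omega), if_neg (by omega), zero_add]

theorem mul_stirlingFirst_two_pow (h k : ℕ) (hh : 0 < h) (hk : 0 < k) :
    ∃ w : ℤ, (k * Nat.stirlingFirst (2 ^ h) k : ℤ) = 2 ^ (h - 1) * w ∧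
      (Odd w ↔ IsLowIndex h k) := by
  obtain rfl | ⟨r, rfl⟩ : h = 1 ∨ ∃ r, h = r + 2 := by
    rcases h with _ | _ | r <;> simp_all
  -- The congruence starts at h = 2; for h = 1 the power of two is 1.
  · refine ⟨k * Nat.stirlingFirst (2 ^ 1) k, by simp, ?_⟩
    unfold IsLowIndex
    rcases k with _ | _ | _ | k
    · omega
    · decide
    · decide
    · rw [Nat.stirlingFirst_eq_zero_of_lt (by omega)]
      simp
  · obtain ⟨A, B, -, hB⟩ := ascPochhammer_two_pow_congr r
    set F : ℤ[X] := X * ((X * (X + 1)) ^ (2 ^ (r + 1) - 2) * (X * (X + 1) + 1)) with hF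
    refine ⟨F.coeff k + 2 * (X * B).coeff k, ?_, ?_⟩
    · have h1 : X * derivative (ascPochhammer ℤ (2 ^ (r + 2))) =
          C ((2 : ℤ) ^ (r + 1)) * (F + C 2 * (X * B)) := by
        rw [hB, hF]; simp; ring
      have h2 := congrArg (fun p => coeff p k) h1
      simp only [coeff_C_mul, coeff_add] at h2
      rw [show r + 2 - 1 = r + 1 by rfl, ← h2]
      obtain ⟨j, rfl⟩ := Nat.exists_eq_succ_of_ne_zero hk.ne'
      rw [Nat.succ_eq_add_one, coeff_X_mul, coeff_derivative, coeff_ascPochhammer_int]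
      push_cast; ring
    · have h3 := coeff_leading_term r k hk
      have h4 : F.map (Int.castRingHom (ZMod 2)) =
          X * ((X * (X + 1)) ^ (2 ^ (r + 1) - 2) * (X * (X + 1) + 1)) := by
        simp [hF, Polynomial.map_mul, Polynomial.map_pow]
      rw [← h4, coeff_map, eq_intCast] at h3
      have h5 : Odd (F.coeff k + 2 * (X * B).coeff k) ↔ Odd (F.coeff k) := by
        simp [Int.odd_add]
      rw [h5, ← Int.not_even_iff_odd, ← ZMod.intCast_eq_zero_iff_even, h3]
      split_ifs with hc <;> simp [hc]

/-- `s(2 ^ h, k)` is odd only for `k = 2 ^ (h - 1)` and `k = 2 ^ h`. -/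
theorem odd_stirlingFirst_two_pow (h k : ℕ) (hh : 0 < h) (hk : k < 2 ^ h) :
    Odd (Nat.stirlingFirst (2 ^ h) k) ↔ k = 2 ^ (h - 1) := by
  have key : ∃ A : ℤ[X], ascPochhammer ℤ (2 ^ h) = (X * (X + 1)) ^ (2 ^ (h - 1)) + C 2 * A := by
    obtain rfl | ⟨r, rfl⟩ : h = 1 ∨ ∃ r, h = r + 2 := by
      rcases h with _ | _ | r <;> simp_all
    · exact ⟨0, by simp [show 2 = 1 + 1 by rfl, ascPochhammer_succ_right]⟩
    · obtain ⟨A, B, hA, -⟩ := ascPochhammer_two_pow_congr r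
      exact ⟨A, by rw [hA]; simp⟩
  obtain ⟨A, hA⟩ := key
  have h1 := congrArg (fun p => coeff (p.map (Int.castRingHom (ZMod 2))) k) hA
  have h2 : (C 2 * A).map (Int.castRingHom (ZMod 2)) = 0 := by
    rw [Polynomial.map_mul, map_C, show (Int.castRingHom (ZMod 2)) 2 = 0 by rfl]; simp
  simp only [coeff_map, coeff_ascPochhammer_int, Polynomial.map_add, h2] at h1
  simp only [Polynomial.map_pow, Polynomial.map_mul, map_X, Polynomial.map_add,
    mul_pow, add_pow_char_pow, add_zero, mul_add, mul_one,
    ← pow_add, coeff_add, coeff_X_pow, ← two_mul, ← pow_succ', Nat.sub_add_cancel hh] at h1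
  rw [if_neg hk.ne, zero_add] at h1
  rw [← Nat.not_even_iff_odd, ← ZMod.natCast_eq_zero_iff_even]
  rw [eq_intCast, Int.cast_natCast] at h1
  rw [h1]
  split_ifs with hc <;> simp [hc]

end risingFactorial

end StirlingCases

namespace StirlingCases

/-! ### Higher order Bernoulli polynomials in terms of Stirling numbers -/

section bernoulli
open PowerSeries
open scoped Polynomial

theorem expSubOneDivT_mul_inv : expSubOneDivT * expSubOneDivT⁻¹ = 1 :=
  PowerSeries.mul_inv_cancel _ (by simp [expSubOneDivT])

/-- With f = (e^t - 1)/t, both sides are e^t = (tf)' = 1 + tf. -/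
theorem expSubOneDivT_add_X_mul_derivative :
    expSubOneDivT + X * d⁄dX ℚ expSubOneDivT = 1 + X * expSubOneDivT := by
  ext i
  cases i with
  | zero => simp [expSubOneDivT]
  | succ i =>
    have hf : ((i + 1).factorial : ℚ) ≠ 0 := by positivity
    simp only [map_add, coeff_succ_X_mul, coeff_derivative, expSubOneDivT, coeff_mk, coeff_one,
      Nat.factorial_succ (i + 1), Nat.succ_ne_zero, if_false]
    push_cast
    field_simp
    ring

theorem X_mul_derivative_inv :
    X * d⁄dX ℚ expSubOneDivT⁻¹ =
      expSubOneDivT⁻¹ - X * expSubOneDivT⁻¹ - expSubOneDivT⁻¹ ^ 2 := by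
  rw [derivative_inv']
  linear_combination (-expSubOneDivT⁻¹ ^ 2) * expSubOneDivT_add_X_mul_derivative +
    (expSubOneDivT⁻¹ - X * expSubOneDivT⁻¹) * expSubOneDivT_mul_inv

/-- With g = t/(e^t - 1), compare coefficients in t(g^l)' = l(g^l - t g^l - g^(l+1)). This recursion
in the order matches the Stirling recurrence. -/
theorem coeff_inv_pow_succ (l r : ℕ) :
    (l : ℚ) * coeff (r + 1) (expSubOneDivT⁻¹ ^ (l + 1)) =
      ((l : ℚ) - (r + 1)) * coeff (r + 1) (expSubOneDivT⁻¹ ^ l) -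
        l * coeff r (expSubOneDivT⁻¹ ^ l) := by
  cases l with
  | zero => simp [PowerSeries.coeff_one]
  | succ l =>
    have h1 : X * d⁄dX ℚ (expSubOneDivT⁻¹ ^ (l + 1)) =
        ((l + 1 : ℕ) : ℚ⟦X⟧) * (expSubOneDivT⁻¹ ^ (l + 1) - X * expSubOneDivT⁻¹ ^ (l + 1) -
          expSubOneDivT⁻¹ ^ (l + 1 + 1)) := by
      rw [Derivation.leibniz_pow, nsmul_eq_mul, smul_eq_mul, Nat.add_sub_cancel]
      linear_combination ((l + 1 : ℕ) : ℚ⟦X⟧) * expSubOneDivT⁻¹ ^ l * X_mul_derivative_inv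
    have h2 := congrArg (coeff (r + 1)) h1
    rw [← nsmul_eq_mul, map_nsmul, nsmul_eq_mul] at h2
    simp only [map_sub, coeff_succ_X_mul, coeff_derivative] at h2
    linarith

/-- The numbers `B_r^{(l + 1)} / r!` with `r ≤ l` in terms of Stirling numbers. -/
theorem coeff_inv_pow (l r : ℕ) (hr : r ≤ l) :
    coeff r (expSubOneDivT⁻¹ ^ (l + 1)) =
      (-1) ^ r * Nat.stirlingFirst (l + 1) (l + 1 - r) * (l - r).factorial / l.factorial := by
  induction l generalizing r with
  | zero =>
    obtain rfl : r = 0 := by omega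
    simp [expSubOneDivT, Nat.stirlingFirst_self]
  | succ l ih =>
    have hf : (l.factorial : ℚ) ≠ 0 := by positivity
    cases r with
    | zero => simp [expSubOneDivT, Nat.factorial_ne_zero, Nat.stirlingFirst_self]
    | succ r =>
      have h1 := coeff_inv_pow_succ (l + 1) r
      have h2 := ih r (by omega)
      have h3 : ((l + 1 : ℕ) - (r + 1) : ℚ) * coeff (r + 1) (expSubOneDivT⁻¹ ^ (l + 1)) =
          (-1) ^ (r + 1) * Nat.stirlingFirst (l + 1) (l - r) * (l - r).factorial / l.factorial := by
        -- At r = l the induction hypothesis is unavailable, but both sides vanish: the left factor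
        -- is zero and s(l+1,0) = 0.
        rcases (show r ≤ l by omega).eq_or_lt with rfl | hlt
        · simp
        · rw [ih (r + 1) (by omega)]
          obtain ⟨d, rfl⟩ := Nat.exists_eq_add_of_lt hlt
          rw [show r + d + 1 - r = d + 1 by omega, show r + d + 1 - (r + 1) = d by omega,
            show r + d + 1 + 1 - (r + 1) = d + 1 by omega, Nat.factorial_succ d]
          push_cast; ring
      rw [h3, h2] at h1
      obtain ⟨d, rfl⟩ := Nat.exists_eq_add_of_le (show r ≤ l by omega)
      rw [show r + d + 1 + 1 - (r + 1) = d + 1 by omega, show r + d + 1 - (r + 1) = d by omega,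
        Nat.stirlingFirst_succ_succ, Nat.factorial_succ (r + d)]
      rw [show r + d + 1 - r = d + 1 by omega, show r + d - r = d by omega] at h1
      have hl : ((r + d + 1 : ℕ) : ℚ) ≠ 0 := by positivity
      refine mul_left_cancel₀ hl ?_
      rw [h1]
      push_cast at hl ⊢
      field_simp
      ring

theorem coeff_higherBernoulli (l n i : ℕ) :
    (higherBernoulli l n).coeff i =
      if i ≤ n then (n.factorial : ℚ) / i.factorial * coeff (n - i) (expSubOneDivT⁻¹ ^ l)
      else 0 := by
  unfold higherBernoulli
  rw [Polynomial.coeff_smul, PowerSeries.coeff_mul, Polynomial.finsetSum_coeff]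
  have key : ∀ x ∈ Finset.HasAntidiagonal.antidiagonal n,
      (coeff x.1 (PowerSeries.map (Polynomial.C : ℚ →+* ℚ[X]) (expSubOneDivT⁻¹ ^ l)) *
        coeff x.2 (rescale (Polynomial.X : ℚ[X]) (PowerSeries.exp ℚ[X]))).coeff i =
      if x = (n - i, i) ∧ i ≤ n then coeff (n - i) (expSubOneDivT⁻¹ ^ l) / i.factorial else 0 := by
    rintro ⟨a, b⟩ hab
    rw [Finset.HasAntidiagonal.mem_antidiagonal] at hab
    simp only at hab
    rw [PowerSeries.coeff_map, PowerSeries.coeff_rescale, PowerSeries.coeff_exp,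
      Polynomial.coeff_C_mul, Polynomial.algebraMap_eq, Polynomial.coeff_mul_C,
      Polynomial.coeff_X_pow]
    simp only [Prod.mk.injEq]
    by_cases hb : i = b
    · subst hb
      rw [if_pos rfl, if_pos (by omega), show n - i = a by omega]
      simp [div_eq_mul_inv]
    · rw [if_neg hb, if_neg (by omega)]; simp
  rw [Finset.sum_congr rfl key]
  by_cases hi : i ≤ n
  · simp only [hi, and_true, if_true]
    rw [Finset.sum_ite_eq' , if_pos (by simp [hi]), smul_eq_mul]
    ring
  · simp [hi]

end bernoulli

/-- `B_{n - k}^{(n + 1)}(x)` up to the factor `binom n k` and signs. -/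
theorem choose_mul_coeff_higherBernoulli (n k i : ℕ) (hk : k ≤ n) :
    (n.choose k : ℚ) * (higherBernoulli (n + 1) (n - k)).coeff i =
      (((-1) ^ (n - k - i) * ((k + i).choose k * Nat.stirlingFirst (n + 1) (k + i + 1)) : ℤ) : ℚ) := by
  rw [coeff_higherBernoulli]
  by_cases hi : i ≤ n - k
  · obtain ⟨d, rfl⟩ := Nat.exists_eq_add_of_le (show k + i ≤ n by omega)
    rw [if_pos hi, coeff_inv_pow _ _ (by omega), show k + i + d - k - i = d by omega,
      show k + i + d + 1 - d = k + i + 1 by omega, show k + i + d - d = k + i by omega,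
      show k + i + d - k = i + d by omega]
    push_cast
    rw [Nat.cast_choose ℚ (show k ≤ k + i + d by omega), Nat.cast_add_choose,
      show k + i + d - k = i + d by omega]
    have h1 := Nat.cast_ne_zero (R := ℚ).2 (Nat.factorial_ne_zero (k + i + d))
    have h2 := Nat.cast_ne_zero (R := ℚ).2 (Nat.factorial_ne_zero (i + d))
    have h3 := Nat.cast_ne_zero (R := ℚ).2 (Nat.factorial_ne_zero i)
    have h4 := Nat.cast_ne_zero (R := ℚ).2 (Nat.factorial_ne_zero k)
    field_simp
  · rw [if_neg hi, Nat.stirlingFirst_eq_zero_of_lt (by omega)]; simp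

end StirlingCases

namespace StirlingCases

/-! ### Maximum poles as minimal valuations -/

section pole
open Polynomial

/-- ν(D) minus the maximum pole is the least valuation of the integers z i. As `maxPole` is never
negative, this needs a coefficient of F equal to 1, which is what `h₀` provides: it forces e ≤ ν(D).
-/
theorem add_maxPole_le_iff (p : ℕ) [hp : Fact p.Prime] (F : ℚ[X]) (D : ℕ) (hD : D ≠ 0)
    (z : ℕ → ℤ) (hz : ∀ i, (D : ℚ) * F.coeff i = z i) (i₀ : ℕ) (h₀ : z i₀ = D) (e : ℕ) :
    e + maxPole p F ≤ padicValNat p D ↔ ∀ i, (p : ℤ) ^ e ∣ z i := by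
  have hcoef (i : ℕ) : (p : ℤ) ^ e ∣ z i ↔
      z i = 0 ∨ e + padicValNat p (F.coeff i).den ≤
        padicValNat p D + padicValNat p (F.coeff i).num.natAbs := by
    have h1 : z i * (F.coeff i).den = D * (F.coeff i).num := by
      have h := hz i
      rw [← Rat.num_div_den (F.coeff i)] at h
      have hd : ((F.coeff i).den : ℚ) ≠ 0 := by exact_mod_cast (F.coeff i).den_nz
      rw [mul_div_assoc', div_eq_iff hd] at h
      exact_mod_cast h.symm
    rcases eq_or_ne (z i) 0 with h | h
    · simp [h]
    have h2 : (z i).natAbs * (F.coeff i).den = D * (F.coeff i).num.natAbs := by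
      have := congrArg Int.natAbs h1
      simpa [Int.natAbs_mul] using this
    have hza : (z i).natAbs ≠ 0 := Int.natAbs_ne_zero.2 h
    have hnum : (F.coeff i).num.natAbs ≠ 0 := by
      intro h0
      rw [h0, mul_zero] at h2
      exact mul_ne_zero hza (F.coeff i).den_nz h2
    have h3 := congrArg (padicValNat p) h2
    rw [padicValNat.mul hza (F.coeff i).den_nz, padicValNat.mul hD hnum] at h3
    have h4 : (p : ℤ) ^ e ∣ z i ↔ p ^ e ∣ (z i).natAbs := by
      rw [← Int.natCast_pow, Int.natCast_dvd]
    rw [h4, padicValNat_dvd_iff_le hza]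
    simp only [h, false_or]
    omega
  constructor
  · intro hle i
    rw [hcoef]
    by_cases hi : F.coeff i = 0
    · left
      have := hz i
      rw [hi, mul_zero] at this
      exact_mod_cast this.symm
    · right
      have : padicValNat p (F.coeff i).den ≤ maxPole p F :=
        Finset.le_sup (f := fun i => padicValNat p (F.coeff i).den) (mem_support_iff.2 hi)
      omega
  · intro hall
    have he : e ≤ padicValNat p D := by
      have h := hall i₀
      rw [h₀] at h
      exact (padicValNat_dvd_iff_le hD).1 (by exact_mod_cast h)
    suffices maxPole p F ≤ padicValNat p D - e by omega
    refine Finset.sup_le fun i hi => ?_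
    have hi' := mem_support_iff.1 hi
    by_cases hden : p ∣ (F.coeff i).den
    · have hnd : ¬ p ∣ (F.coeff i).num.natAbs := fun hn =>
        Nat.not_coprime_of_dvd_of_dvd hp.out.one_lt hn hden (F.coeff i).reduced
      rcases (hcoef i).1 (hall i) with h | h
      · have := hz i
        rw [h] at this
        simp [hD, hi'] at this
      · rw [padicValNat.eq_zero_of_not_dvd hnd] at h
        omega
    · simp [padicValNat.eq_zero_of_not_dvd hden]

theorem add_maxPole_higherBernoulli_le_iff (p : ℕ) [Fact p.Prime] (n k : ℕ) (hk : k ≤ n) (e : ℕ) :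
    e + maxPole p (higherBernoulli (n + 1) (n - k)) ≤ padicValNat p (n.choose k) ↔
      ∀ i, p ^ e ∣ (k + i).choose k * Nat.stirlingFirst (n + 1) (k + i + 1) := by
  rw [add_maxPole_le_iff p _ _ (Nat.choose_pos hk).ne' _
    (fun i => choose_mul_coeff_higherBernoulli n k i hk) (n - k)]
  · refine forall_congr' fun i => ?_
    rw [IsUnit.dvd_mul_left (isUnit_one.neg.pow _)]
    norm_cast
  · rw [Nat.sub_self, show k + (n - k) = n by omega, Nat.stirlingFirst_self]
    simp

/-- Divisibility of all coefficients of a Hasse derivative is invariant under translation. -/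
theorem dvd_coeff_hasseDeriv_taylor {R : Type*} [CommRing R] (k : ℕ) (a r : R) (f : R[X]) :
    (∀ i, a ∣ (hasseDeriv k (taylor r f)).coeff i) ↔ ∀ i, a ∣ (hasseDeriv k f).coeff i := by
  have hcomm (r : R) (f : R[X]) : hasseDeriv k (taylor r f) = taylor r (hasseDeriv k f) := by
    ext i
    rw [hasseDeriv_coeff, taylor_coeff, taylor_coeff, ← LinearMap.comp_apply, hasseDeriv_comp,
      LinearMap.smul_apply, eval_smul, nsmul_eq_mul, Nat.choose_symm_add]
  have key (r : R) (f : R[X]) (h : C a ∣ hasseDeriv k f) :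
      C a ∣ hasseDeriv k (taylor r f) := by
    obtain ⟨q, hq⟩ := h
    exact ⟨taylor r q, by rw [hcomm, hq, taylor_mul, taylor_C]⟩
  rw [← C_dvd_iff_dvd_coeff, ← C_dvd_iff_dvd_coeff]
  refine ⟨fun h => ?_, key r f⟩
  have := key (-r) _ h
  rwa [taylor_taylor, neg_add_cancel, taylor_zero] at this

/-- Since P_{n+1}(x) = x P_n(x+1), the numbers s(n+1,j+1) are the coefficients of the translate
P_n(x+1). -/
theorem forall_dvd_choose_mul_stirlingFirst_succ (a n k : ℕ) :
    (∀ i, a ∣ (k + i).choose k * Nat.stirlingFirst (n + 1) (k + i + 1)) ↔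
      ∀ i, a ∣ (k + i).choose k * Nat.stirlingFirst n (k + i) := by
  have h := dvd_coeff_hasseDeriv_taylor k (a : ℤ) 1 (ascPochhammer ℤ n)
  have h1 (j : ℕ) : (taylor 1 (ascPochhammer ℤ n)).coeff j =
      (Nat.stirlingFirst (n + 1) (j + 1) : ℤ) := by
    rw [← coeff_ascPochhammer_int, ascPochhammer_succ_left, coeff_X_mul, taylor_apply, C_1]
  simp only [hasseDeriv_coeff, h1, coeff_ascPochhammer_int, add_comm _ k] at h
  exact_mod_cast h

end pole

/-! ### Criteria for AMZC and SAMZC -/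

/-- By `hM`, b - M is the largest exponent dividing every t i, and `hst` bounds it by ν(s); hence
equality holds iff p^ν(s) divides every t i. -/
theorem padicValNat_eq_sub_maxPole_iff (p : ℕ) [Fact p.Prime] (s b : ℕ) (M : ℕ) (t : ℕ → ℕ)
    (hM : ∀ e, e + M ≤ b ↔ ∀ i, p ^ e ∣ t i) (hs : s ≠ 0)
    (hst : ∀ e, (∀ i, p ^ e ∣ t i) → p ^ e ∣ s) :
    (padicValNat p s : ℤ) = (b : ℤ) - (M : ℤ) ↔ ∀ i, p ^ padicValNat p s ∣ t i := by
  rw [← hM]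
  constructor
  · intro h; omega
  · intro h
    have h1 : ¬ padicValNat p s + 1 + M ≤ b := fun h2 => by
      have h3 := (padicValNat_dvd_iff_le hs).1 (hst _ ((hM _).1 h2))
      omega
    omega

theorem isSAMZC_iff (p : ℕ) [Fact p.Prime] (n k : ℕ) (hk : k ≤ n) :
    IsSAMZC p n k ↔ Nat.stirlingFirst n k ≠ 0 ∧
      ∀ i, p ^ padicValNat p (Nat.stirlingFirst n k) ∣
        (k + i).choose k * Nat.stirlingFirst n (k + i) := by
  unfold IsSAMZC
  refine and_congr_right fun hs => padicValNat_eq_sub_maxPole_iff p _ _ _ _ (fun e => ?_) hs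
    fun e h => by simpa using h 0
  rw [add_maxPole_higherBernoulli_le_iff p n k hk, forall_dvd_choose_mul_stirlingFirst_succ]

theorem isAMZC_iff (p : ℕ) [Fact p.Prime] (n k : ℕ) (hk : k ≤ n) :
    IsAMZC p (n + 1) (k + 1) ↔ Nat.stirlingFirst (n + 1) (k + 1) ≠ 0 ∧
      ∀ i, p ^ padicValNat p (Nat.stirlingFirst (n + 1) (k + 1)) ∣
        (k + i).choose k * Nat.stirlingFirst (n + 1) (k + i + 1) := by
  unfold IsAMZC
  rw [Nat.add_sub_cancel, Nat.add_sub_cancel, Nat.add_sub_add_right]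
  exact and_congr_right fun hs => padicValNat_eq_sub_maxPole_iff p _ _ _ _
    (add_maxPole_higherBernoulli_le_iff p n k hk) hs fun e h => by simpa using h 0

/-! ### The three cases for `n = 2 ^ h` -/

theorem stirlingFirst_pos {n k : ℕ} (hk : 0 < k) (hkn : k ≤ n) : 0 < Nat.stirlingFirst n k := by
  induction n generalizing k with
  | zero => omega
  | succ n ih =>
    obtain ⟨k, rfl⟩ := Nat.exists_eq_succ_of_ne_zero hk.ne'
    rw [Nat.succ_eq_add_one, Nat.stirlingFirst_succ_succ]
    rcases Nat.eq_zero_or_pos k with rfl | hk0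
    · rcases Nat.eq_zero_or_pos n with rfl | hn
      · simp
      · exact Nat.add_pos_left (Nat.mul_pos hn (ih one_pos hn)) _
    · exact Nat.add_pos_right _ (ih hk0 (by omega))

theorem padicValNat_mul_stirlingFirst_iff (h k e : ℕ) (hk : 0 < k) (hkn : k ≤ 2 ^ h) :
    2 ^ e ∣ k * Nat.stirlingFirst (2 ^ h) k ↔
      e ≤ padicValNat 2 k + padicValNat 2 (Nat.stirlingFirst (2 ^ h) k) := by
  have hs := (stirlingFirst_pos hk hkn).ne'
  rw [padicValNat_dvd_iff_le (mul_ne_zero hk.ne' hs), padicValNat.mul hk.ne' hs]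

theorem two_pow_pred_dvd_mul_stirlingFirst (h k : ℕ) (hh : 0 < h) (hk : 0 < k) :
    2 ^ (h - 1) ∣ k * Nat.stirlingFirst (2 ^ h) k := by
  obtain ⟨w, hw, -⟩ := mul_stirlingFirst_two_pow h k hh hk
  exact_mod_cast Dvd.intro w hw.symm

theorem two_pow_dvd_mul_stirlingFirst_iff (h k : ℕ) (hh : 0 < h) (hk : 0 < k) :
    2 ^ h ∣ k * Nat.stirlingFirst (2 ^ h) k ↔ ¬ IsLowIndex h k := by
  obtain ⟨w, hw, hodd⟩ := mul_stirlingFirst_two_pow h k hh hk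
  rw [← hodd, Int.not_odd_iff_even, even_iff_two_dvd]
  have h1 : (2 : ℤ) ^ h = 2 ^ (h - 1) * 2 := by rw [← pow_succ, Nat.sub_add_cancel hh]
  rw [← mul_dvd_mul_iff_left (show (2 : ℤ) ^ (h - 1) ≠ 0 by positivity), ← h1, ← hw]
  norm_cast

theorem padicValNat_stirlingFirst_of_isLowIndex (h k : ℕ) (hh : 0 < h) (hk : 0 < k)
    (hkn : k ≤ 2 ^ h) (hc : IsLowIndex h k) :
    padicValNat 2 k + padicValNat 2 (Nat.stirlingFirst (2 ^ h) k) = h - 1 := by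
  have h1 := (padicValNat_mul_stirlingFirst_iff h k _ hk hkn).1
    (two_pow_pred_dvd_mul_stirlingFirst h k hh hk)
  have h2 := (two_pow_dvd_mul_stirlingFirst_iff h k hh hk).not.2 (not_not.2 hc)
  rw [padicValNat_mul_stirlingFirst_iff h k _ hk hkn] at h2
  omega

theorem IsLowIndex.lt {h k : ℕ} (hc : IsLowIndex h k) : k < 2 ^ h := by
  have h1 := Nat.one_le_two_pow (n := h)
  have h2 := Nat.pow_le_pow_right (n := 2) two_pos (Nat.sub_le h 1)
  have h3 := Nat.one_le_two_pow (n := h - 1)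
  rcases hc with hc | hc | hc <;> omega

theorem mul_choose_add (k i : ℕ) (hk : 0 < k) :
    k * (k + i).choose k = (k + i) * (k + i - 1).choose (k - 1) := by
  obtain ⟨k, rfl⟩ := Nat.exists_eq_succ_of_ne_zero hk.ne'
  rw [Nat.succ_eq_add_one, show k + 1 + i = (k + i) + 1 by ring, Nat.add_sub_cancel,
    Nat.add_sub_cancel, Nat.add_one_mul_choose_eq]
  ring

open Polynomial in
theorem odd_choose_two_pow_sub_one (a j : ℕ) (hj : j < 2 ^ a) :
    Odd ((2 ^ a - 1).choose j) := by
  have h := congrArg (fun p => coeff p j) (one_add_X_pow_two_pow_sub_one a)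
  simp only [coeff_one_add_X_pow, finsetSum_coeff, coeff_X_pow, Finset.sum_ite_eq,
    Finset.mem_range, hj, if_true] at h
  rw [← Nat.not_even_iff_odd, ← ZMod.natCast_eq_zero_iff_even, h]
  exact one_ne_zero

/-- After multiplication by k the competitors are binom(k+i-1,k-1) (k+i) s(n,k+i), all divisible by
2^(h-1). A low k attains this bound at i = 0; any other k is beaten by a low k+i with odd binomial.
-/
theorem isSAMZC_two_pow_iff (h k : ℕ) (hh : 0 < h) (hk : 0 < k) (hkn : k < 2 ^ h) :
    IsSAMZC 2 (2 ^ h) k ↔ IsLowIndex h k := by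
  have hs := (stirlingFirst_pos hk hkn.le).ne'
  rw [isSAMZC_iff 2 _ _ hkn.le]
  have hval (e i : ℕ) : 2 ^ e ∣ (k + i).choose k * Nat.stirlingFirst (2 ^ h) (k + i) ↔
      2 ^ (padicValNat 2 k + e) ∣
        (k + i - 1).choose (k - 1) * ((k + i) * Nat.stirlingFirst (2 ^ h) (k + i)) := by
    have h1 : (k + i - 1).choose (k - 1) * ((k + i) * Nat.stirlingFirst (2 ^ h) (k + i)) =
        k * ((k + i).choose k * Nat.stirlingFirst (2 ^ h) (k + i)) := by
      rw [← mul_assoc, ← mul_assoc, mul_choose_add k i hk]; ring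
    rw [h1]
    rcases eq_or_ne ((k + i).choose k * Nat.stirlingFirst (2 ^ h) (k + i)) 0 with h0 | h0
    · simp [h0]
    · rw [padicValNat_dvd_iff_le h0, padicValNat_dvd_iff_le (mul_ne_zero hk.ne' h0),
        padicValNat.mul hk.ne' h0]
      omega
  simp only [hval]
  constructor
  · rintro ⟨-, hall⟩
    by_contra hc
    have h1 := (two_pow_dvd_mul_stirlingFirst_iff h k hh hk).2 hc
    rw [padicValNat_mul_stirlingFirst_iff h k _ hk hkn.le] at h1
    have h2 (i : ℕ) (hodd : Odd ((k + i - 1).choose (k - 1))) (hl : IsLowIndex h (k + i)) :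
        False := by
      have h3 := (pow_dvd_pow 2 h1).trans (hall i)
      have h4 := (Nat.Coprime.pow_left h (Nat.coprime_two_left.2 hodd)).dvd_of_dvd_mul_left h3
      exact (two_pow_dvd_mul_stirlingFirst_iff h (k + i) hh (by omega)).1 h4 hl
    have hp : 2 ^ h = 2 * 2 ^ (h - 1) := by rw [← pow_succ', Nat.sub_add_cancel hh]
    have hp1 := Nat.one_le_two_pow (n := h - 1)
    by_cases hkm : k < 2 ^ (h - 1)
    -- Compare with the low index 2^(h-1), whose binomial has upper entry 2^(h-1) - 1.
    · refine h2 (2 ^ (h - 1) - k) ?_ ?_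
      · rw [show k + (2 ^ (h - 1) - k) = 2 ^ (h - 1) by omega]
        exact odd_choose_two_pow_sub_one _ _ (by omega)
      · rw [show k + (2 ^ (h - 1) - k) = 2 ^ (h - 1) by omega]
        refine Or.inl ⟨?_, le_rfl, by omega⟩
        refine (even_two).pow_of_ne_zero ?_
        rintro h0
        rw [h0] at hkm
        omega
    · unfold IsLowIndex at hc
      have hodd : Odd k := by
        rw [← Nat.not_even_iff_odd]
        exact fun he => hc (Or.inl ⟨he, by omega, hkn⟩)
      -- Here k is odd, so k+1 is low with binomial binom(k,k-1) = k; k ≠ 2^h - 1 keeps k+1 below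
      -- 2^h.
      refine h2 1 ?_ (Or.inl ⟨hodd.add_one, by omega, by omega⟩)
      rw [Nat.add_sub_cancel, Nat.choose_symm_of_eq_add (show k = (k - 1) + 1 by omega)]
      simpa using hodd
  · refine fun hc => ⟨hs, fun i => ?_⟩
    rw [padicValNat_stirlingFirst_of_isLowIndex h k hh hk hkn.le hc]
    exact (two_pow_pred_dvd_mul_stirlingFirst h (k + i) hh (by omega)).mul_left _

/-- The competitor with k+i = n is binom(n-1,k-1) s(n,n), which is odd, so sharpness means that
s(n,k) is odd. -/
theorem isAMZC_two_pow_iff (h k : ℕ) (hh : 0 < h) (hk : 0 < k) (hkn : k < 2 ^ h) :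
    IsAMZC 2 (2 ^ h) k ↔ k = 2 ^ (h - 1) := by
  have hs := (stirlingFirst_pos hk hkn.le).ne'
  rw [← odd_stirlingFirst_two_pow h k hh hkn]
  obtain ⟨j, rfl⟩ := Nat.exists_eq_succ_of_ne_zero hk.ne'
  obtain ⟨m, hm⟩ := Nat.exists_eq_succ_of_ne_zero (Nat.two_pow_pos h).ne'
  rw [Nat.succ_eq_add_one] at *
  rw [hm] at hs hkn ⊢
  rw [isAMZC_iff 2 m j (by omega), and_iff_right hs]
  constructor
  · intro hall
    have h1 := hall (m - j)
    rw [show j + (m - j) = m by omega, Nat.stirlingFirst_self, mul_one] at h1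
    have hodd := odd_choose_two_pow_sub_one h j (by omega)
    rw [hm, Nat.add_sub_cancel] at hodd
    have h2 := Nat.Coprime.eq_one_of_dvd (Nat.Coprime.pow_left _ (Nat.coprime_two_left.2 hodd)) h1
    rw [← Nat.not_even_iff_odd, even_iff_two_dvd]
    intro h3
    have h4 := (dvd_iff_padicValNat_ne_zero hs).1 h3
    exact h4 (by simpa using h2)
  · intro hodd i
    rw [padicValNat.eq_zero_of_not_dvd (by rwa [← even_iff_two_dvd, Nat.not_even_iff_odd])]
    simp

theorem digitSum_two_eq (m : ℕ) : digitSum 2 m = m % 2 + digitSum 2 (m / 2) := by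
  rcases Nat.eq_zero_or_pos m with rfl | hm
  · rfl
  · unfold digitSum
    rw [Nat.digits_def' one_lt_two hm, List.sum_cons]

theorem digitSum_two_pow_sub_one (h : ℕ) : digitSum 2 (2 ^ h - 1) = h := by
  induction h with
  | zero => rfl
  | succ h ih =>
    have := Nat.two_pow_pos h
    rw [digitSum_two_eq, pow_succ, show (2 ^ h * 2 - 1) % 2 = 1 by omega,
      show (2 ^ h * 2 - 1) / 2 = 2 ^ h - 1 by omega, ih, add_comm]

theorem digitSum_lt_of_lt (h m : ℕ) (hm : m < 2 ^ h - 1) : digitSum 2 m < h := by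
  induction h generalizing m with
  | zero => simp at hm
  | succ h ih =>
    rw [pow_succ] at hm
    rw [digitSum_two_eq]
    by_cases hlt : m / 2 < 2 ^ h - 1
    · have := ih _ hlt
      omega
    · rw [show m / 2 = 2 ^ h - 1 by omega, digitSum_two_pow_sub_one]
      omega

/-- The digit sum of n-1 is h and that of k-1 is smaller, so the valuation would be negative. -/
theorem not_isMZC_two_pow (h k : ℕ) (hk : 0 < k) (hkn : k < 2 ^ h) : ¬ IsMZC 2 (2 ^ h) k := by
  rintro ⟨-, h1⟩
  rw [digitSum_two_pow_sub_one] at h1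
  have h2 : (digitSum 2 (k - 1) : ℚ) < h := by
    exact_mod_cast digitSum_lt_of_lt h (k - 1) (by omega)
  have h3 : (0 : ℚ) ≤ padicValNat 2 (Nat.stirlingFirst (2 ^ h) k) := by positivity
  rw [h1] at h3
  norm_num at h3
  linarith

/-- In s(n+1,k+1) = n s(n,k+1) + s(n,k) with k < n, the first term is divisible by 2^h while
ν(s(n,k)) ≤ h-1. For k = n both numbers are 1. -/
theorem padicValNat_stirlingFirst_succ_succ (h k : ℕ) (hS : IsSAMZC 2 (2 ^ h) k) :
    padicValNat 2 (Nat.stirlingFirst (2 ^ h + 1) (k + 1)) =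
      padicValNat 2 (Nat.stirlingFirst (2 ^ h) k) := by
  have hs := hS.1
  have hn := (Nat.two_pow_pos h).ne'
  have hk : 0 < k := by
    rcases Nat.eq_zero_or_pos k with rfl | hk
    · obtain ⟨m, hm⟩ := Nat.exists_eq_succ_of_ne_zero hn
      rw [hm, Nat.stirlingFirst_succ_zero] at hs
      exact absurd rfl hs
    · exact hk
  have hle : k ≤ 2 ^ h := by
    by_contra hlt
    exact hs (Nat.stirlingFirst_eq_zero_of_lt (by omega))
  rcases hle.eq_or_lt with rfl | hlt
  · rw [Nat.stirlingFirst_self, Nat.stirlingFirst_self]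
  have hh : 0 < h := by
    rcases Nat.eq_zero_or_pos h with rfl | hh
    · simp at hlt; omega
    · exact hh
  have hv := padicValNat_stirlingFirst_of_isLowIndex h k hh hk hle
    ((isSAMZC_two_pow_iff h k hh hk hlt).1 hS)
  have hdvd (e : ℕ) (he : e ≤ h) :
      2 ^ e ∣ Nat.stirlingFirst (2 ^ h + 1) (k + 1) ↔ 2 ^ e ∣ Nat.stirlingFirst (2 ^ h) k := by
    rw [Nat.stirlingFirst_succ_succ]
    exact Nat.dvd_add_right ((pow_dvd_pow 2 he).mul_right _)
  have hs' := (stirlingFirst_pos (show 0 < k + 1 by omega)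
    (show k + 1 ≤ 2 ^ h + 1 by omega)).ne'
  simp only [padicValNat_dvd_iff_le hs, padicValNat_dvd_iff_le hs'] at hdvd
  have h1 := (hdvd (padicValNat 2 (Nat.stirlingFirst (2 ^ h) k)) (by omega)).2 le_rfl
  have h2 := (hdvd (padicValNat 2 (Nat.stirlingFirst (2 ^ h) k) + 1) (by omega)).not.2 (by omega)
  omega

end StirlingCases

theorem mainTheorem10 (h : ℕ) :
    (∀ k : ℕ, 0 < k → k < 2 ^ h →
      (StirlingCases.IsSAMZC 2 (2 ^ h) k ↔
        (Even k ∧ 2 ^ (h - 1) ≤ k ∧ k < 2 ^ h) ∨ k = 2 ^ h - 1 ∨ k = 2 ^ (h - 1) - 1)) ∧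
    (∀ k : ℕ, 0 < k → k < 2 ^ h → ¬ StirlingCases.IsMZC 2 (2 ^ h) k) ∧
    (∀ k : ℕ, 0 < k → k < 2 ^ h →
      (StirlingCases.IsAMZC 2 (2 ^ h) k ↔ k = 2 ^ (h - 1))) ∧
    (∀ k : ℕ, Even k → 2 ^ (h - 1) ≤ k → k < 2 ^ h →
      (padicValNat 2 (Nat.stirlingFirst (2 ^ h) k) : ℤ) = (h : ℤ) - (padicValNat 2 k : ℤ) - 1) ∧
    (∀ k : ℕ, 0 < k → (k = 2 ^ h - 1 ∨ k = 2 ^ (h - 1) - 1) →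
      (padicValNat 2 (Nat.stirlingFirst (2 ^ h) k) : ℤ) = (h : ℤ) - 1 ∧
      (h : ℤ) - 1 = (h : ℤ) - 1 - (padicValNat 2 k : ℤ)) ∧
    (∀ k : ℕ, StirlingCases.IsSAMZC 2 (2 ^ h) k →
      padicValNat 2 (Nat.stirlingFirst (2 ^ h + 1) (k + 1)) =
        padicValNat 2 (Nat.stirlingFirst (2 ^ h) k)) := by
  -- For h = 0 no k satisfies 0 < k < 2^h.
  have hpos (k : ℕ) (hk : 0 < k) (hkn : k < 2 ^ h) : 0 < h := by
    rcases Nat.eq_zero_or_pos h with rfl | hh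
    · simp at hkn; omega
    · exact hh
  have hval (k : ℕ) (hk : 0 < k) (hc : StirlingCases.IsLowIndex h k) :
      (padicValNat 2 (Nat.stirlingFirst (2 ^ h) k) : ℤ) = (h : ℤ) - (padicValNat 2 k : ℤ) - 1 := by
    have hh := hpos k hk hc.lt
    have := StirlingCases.padicValNat_stirlingFirst_of_isLowIndex h k hh hk hc.lt.le hc
    omega
  refine ⟨fun k hk hkn => StirlingCases.isSAMZC_two_pow_iff h k (hpos k hk hkn) hk hkn,
    StirlingCases.not_isMZC_two_pow h,
    fun k hk hkn => StirlingCases.isAMZC_two_pow_iff h k (hpos k hk hkn) hk hkn,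
    fun k he hk hkn => hval k ((Nat.two_pow_pos _).trans_le hk) (Or.inl ⟨he, hk, hkn⟩),
    fun k hk hc => ?_, StirlingCases.padicValNat_stirlingFirst_succ_succ h⟩
  have hlow : StirlingCases.IsLowIndex h k := Or.inr hc
  have hodd : ¬ 2 ∣ k := by
    have h2 (a : ℕ) (ha : k = 2 ^ a - 1) : ¬ 2 ∣ k := by
      rcases Nat.eq_zero_or_pos a with rfl | h0
      · simp at ha; omega
      · have : 2 ∣ 2 ^ a := dvd_pow_self 2 h0.ne'
        have := Nat.two_pow_pos a
        omega
    exact hc.elim (h2 h) (h2 (h - 1))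
  have h1 := hval k hk hlow
  rw [padicValNat.eq_zero_of_not_dvd hodd] at h1 ⊢
  constructor <;> omega
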